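/- Let $V$ be a real inner product space of dimension $n\ge 1$ with orthonormal basis $e_1,\dots,e_n$, and let $m=2k$. Give $V^{\otimes m}$ the dot product with $\langle x_1\otimes\cdots\otimes x_m,\,y_1\otimes\cdots\otimes y_m\rangle=\prod_j\langle x_j,y_j\rangle$ and the diagonal action of the orthogonal group $O(V)\cong O(n)$, and let $\mathcal I_m\subset V^{\otimes m}$ be the subspace of $O(V)$-invariant tensors. A pairing is a partition $\mathcal P=\{J_1,\dots,J_k\}$ of $\{1,\dots,m\}$ into two-element sets; $\Pi_m$ is the set of all pairings, and $$I(\mathcal P)=\sum_{i_1,\dots,i_k=1}^{n} e_{i_1}(J_1)\otimes\cdots\otimes e_{i_k}(J_k),$$ where the summand is the decomposable tensor having the vector $e_{i_r}$ at both positions in $J_r$, for $r=1,\dots,k$. Put $$A_m=\frac1{(2k-1)!!}\sum_{\mathcal P\in\Pi_m}I(\mathcal P),\qquad \mu_{k,n}=\mathbb E\big(\langle x,y\rangle^{2k}\big),$$ where $x,y$ are independent random vectors, each distributed by the $O(V)$-invariant probability measure on the unit sphere of $V$. Suppose that $I(\mathcal P_1),\dots,I(\mathcal P_{m_0})$, with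 $\mathcal P_i\in\Pi_m$, is an ordered basis of $\mathcal I_m$. Then its Gram matrix $\mathcal G_0=\big(\langle I(\mathcal P_i),I(\mathcal P_j)\rangle\big)_{i,j}$ is invertible and, with $s_i$ the sum of the elements of the $i$-th row of $\mathcal G_0^{-1}$, $$\sum_{i=1}^{m_0}s_i\,I(\mathcal P_i)=\mu_{k,n}A_m,\qquad\text{where}\quad \mu_{k,n}=\frac{(2k-1)!!}{n(n+2)\cdots(n+2k-2)}.$$ (For $k=0$, $(-1)!!=1$ and the empty product is $1$.) -/

import Mathlib

open scoped TensorProduct InnerProductSpace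

noncomputable section

namespace InvTensor

/-- The set of pairings of the index set `Fin m`: its partitions into two-element parts. -/
abbrev Pairing (m : ℕ) : Type :=
  {P : Finpartition (Finset.univ : Finset (Fin m)) // ∀ J ∈ P.parts, J.card = 2}

/-- The part of the partition `P` that contains the index `j`. -/
def partOf {m : ℕ} (P : Finpartition (Finset.univ : Finset (Fin m))) (j : Fin m) :
    {J : Finset (Fin m) // J ∈ P.parts} :=
  ⟨P.part j, P.part_mem.2 (Finset.mem_univ j)⟩

section Algebra

variable {V : Type*} [NormedAddCommGroup V] [InnerProductSpace ℝ V]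

/-- The decomposable tensor `v₁(J₁) ⊗ ⋯ ⊗ v_l(J_l)` of a partition `P = {J₁, …, J_l}`: the vector
`v J` stands at all the positions that belong to the part `J`. -/
def placed {m : ℕ} (P : Finpartition (Finset.univ : Finset (Fin m)))
    (v : {J : Finset (Fin m) // J ∈ P.parts} → V) : ⨂[ℝ]^m V :=
  PiTensorProduct.tprod ℝ (fun j : Fin m => v (partOf P j))

/-- The standard invariant `I(P) = ∑_{i₁, …, i_k = 1}^n e_{i₁}(J₁) ⊗ ⋯ ⊗ e_{i_k}(J_k)` of a
pairing `P = {J₁, …, J_k}`; the indices are a function from the parts of `P` to `Fin n`. -/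
def stdInv {n m : ℕ} (e : OrthonormalBasis (Fin n) ℝ V) (P : Pairing m) : ⨂[ℝ]^m V :=
  ∑ i : {J : Finset (Fin m) // J ∈ P.1.parts} → Fin n, placed P.1 (fun J => e (i J))

/-- The dot product on `V^{⊗m}`, determined by its values on decomposable tensors,
see `dot_tprod`. -/
def dot (V : Type*) [NormedAddCommGroup V] [InnerProductSpace ℝ V] (m : ℕ) :
    (⨂[ℝ]^m V) →ₗ[ℝ] (⨂[ℝ]^m V) →ₗ[ℝ] ℝ :=
  PiTensorProduct.dualDistrib ∘ₗ PiTensorProduct.map (fun _ : Fin m => innerₗ V)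

theorem dot_tprod {m : ℕ} (x y : Fin m → V) :
    dot V m (PiTensorProduct.tprod ℝ x) (PiTensorProduct.tprod ℝ y) = ∏ j, ⟪x j, y j⟫_ℝ := by
  simp [dot]

/-- The space of `O(V)`-invariants in `V^{⊗m}`, with `g x₁ ⊗ ⋯ ⊗ g x_m` as the action of `g` on
`x₁ ⊗ ⋯ ⊗ x_m`. -/
def invariants (V : Type*) [NormedAddCommGroup V] [InnerProductSpace ℝ V] (m : ℕ) :
    Submodule ℝ (⨂[ℝ]^m V) :=
  ⨅ g : V ≃ₗᵢ[ℝ] V, LinearMap.eqLocus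
    (PiTensorProduct.map (fun _ : Fin m => g.toLinearEquiv.toLinearMap)) LinearMap.id

/-- Membership in `invariants` is invariance under every element of `O(V)`. -/
theorem mem_invariants {m : ℕ} (t : ⨂[ℝ]^m V) :
    t ∈ invariants V m ↔ ∀ g : V ≃ₗᵢ[ℝ] V,
      PiTensorProduct.map (fun _ : Fin m => g.toLinearEquiv.toLinearMap) t = t := by
  simp [invariants, LinearMap.mem_eqLocus]

/-- The average `A_m` of all the standard invariants for `m = 2k`; there are `(2k-1)!!` of them. -/
def avgInv {n : ℕ} (e : OrthonormalBasis (Fin n) ℝ V) (k : ℕ) : ⨂[ℝ]^(2 * k) V :=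
  (1 / (Nat.doubleFactorial (2 * k - 1) : ℝ)) • ∑ P : Pairing (2 * k), stdInv e P

/-- The Gram matrix of a finite ordered family of tensors. -/
def gram {m m₀ : ℕ} (v : Fin m₀ → ⨂[ℝ]^m V) : Matrix (Fin m₀) (Fin m₀) ℝ :=
  Matrix.of (fun i j => dot V m (v i) (v j))

end Algebra

section Sphere

variable (V : Type*) [NormedAddCommGroup V] [InnerProductSpace ℝ V] [FiniteDimensional ℝ V]
  [MeasurableSpace V] [BorelSpace V]

/-- The `O(V)`-invariant probability measure on the unit sphere `S(V)`: the normalized surface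
measure. -/
def sphereProb : MeasureTheory.Measure (Metric.sphere (0 : V) 1) :=
  ((MeasureTheory.volume : MeasureTheory.Measure V).toSphere Set.univ)⁻¹ •
    (MeasureTheory.volume : MeasureTheory.Measure V).toSphere

/-- The moment `E(⟨x, y⟩^{2k})` of two independent random vectors `x, y`, both uniformly
distributed on the unit sphere of `V`. -/
def sphereMoment (k : ℕ) : ℝ :=
  ∫ p : Metric.sphere (0 : V) 1 × Metric.sphere (0 : V) 1,
    ⟪(p.1 : V), (p.2 : V)⟫_ℝ ^ (2 * k) ∂((sphereProb V).prod (sphereProb V))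

end Sphere

end InvTensor

end

/-! The dot product is positive definite, so the Gram matrix of a linearly independent family is
invertible, and the row sums of its inverse are the coordinates of the unique tensor in the span
having dot product 1 with every member (`sum_rowSum_inv_gram_smul_eq`). Since `A_m` is invariant, it
remains to see that its dot product with each `I(P)` is `1/μ`.

Expand `I(P)` into basis tensors `e_f`, where `f` colours the positions with `n` colours and is
constant on the parts of `P`. As `I(Q)` has dot product 1 or 0 with `e_f`, according to whether `f`
is constant on the parts of `Q`, the sum over `Q` of `⟨I(Q), I(P)⟩` counts compatible pairs of a
colouring of the parts of `P` and a pairing `Q`. Adding the parts one at a time gives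
`n(n+2)⋯(n+2k-2)` (`sum_dot_stdInv_stdInv`).

The moment `μ` is computed independently, from a Gaussian integral in Cartesian and in polar
coordinates (`sphereMoment_eq`). -/

open scoped TensorProduct InnerProductSpace

noncomputable section

namespace InvTensor

/-! ### Moments of the sphere from Gaussian integrals. -/

section SphereMoments

open MeasureTheory MeasureTheory.Measure Set Real

theorem integral_pow_mul_exp_neg_sq_Ioi (q : ℕ) :
    ∫ r in Ioi (0 : ℝ), r ^ q * exp (-r ^ 2) = 1 / 2 * Gamma (((q : ℝ) + 1) / 2) := by
  have h := integral_rpow_mul_exp_neg_rpow (p := 2) (q := q) two_pos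
    (by linarith [q.cast_nonneg (α := ℝ)])
  simpa only [rpow_natCast, rpow_two] using h

theorem integral_even_pow_mul_exp_neg_sq (k : ℕ) :
    ∫ t : ℝ, t ^ (2 * k) * exp (-t ^ 2) = Gamma ((k : ℝ) + 1 / 2) := by
  have h := integral_comp_abs (f := fun t : ℝ => t ^ (2 * k) * exp (-t ^ 2))
  simp only [pow_mul, sq_abs] at h
  simp only [pow_mul]
  rw [h]
  simp only [← pow_mul]
  rw [integral_pow_mul_exp_neg_sq_Ioi]
  push_cast
  rw [show ((2 * k + 1 : ℝ) / 2) = k + 1 / 2 by ring]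
  ring

variable {V : Type*} [NormedAddCommGroup V] [InnerProductSpace ℝ V] [FiniteDimensional ℝ V]

theorem exists_orthonormalBasis_apply_eq {n : ℕ} (hn : Module.finrank ℝ V = n) (i : Fin n) (x : V)
    (hx : ‖x‖ = 1) : ∃ b : OrthonormalBasis (Fin n) ℝ V, b i = x := by
  have ho : Orthonormal ℝ (({i} : Set (Fin n)).domRestrict (fun _ => x)) := by
    refine ⟨fun _ => hx, fun a b hab => (hab (Subsingleton.elim a b)).elim⟩
  obtain ⟨b, hb⟩ := ho.exists_orthonormalBasis_extension_of_card_eq (by simpa using hn)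
  exact ⟨b, hb i rfl⟩

variable [MeasurableSpace V] [BorelSpace V]

/-- Integration in polar coordinates of a function that is a product of a function of the direction
and a function of the norm. -/
theorem integral_polar [Nontrivial V] (F : Metric.sphere (0 : V) 1 → ℝ) (h : ℝ → ℝ)
    (f : V → ℝ) (hf : ∀ (y : Metric.sphere (0 : V) 1) (r : ℝ), 0 < r → f (r • (y : V)) = F y * h r) :
    ∫ v, f v = (∫ y, F y ∂(volume : Measure V).toSphere) *
      ∫ r in Ioi (0 : ℝ), r ^ (Module.finrank ℝ V - 1) * h r := by
  calc
    ∫ v, f v = ∫ x : ({(0)}ᶜ : Set V), f x.1 ∂((volume : Measure V).comap (↑)) := by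
      rw [integral_subtype_comap (measurableSet_singleton _).compl fun x ↦ f x,
        restrict_compl_singleton]
    _ = ∫ x, F x.1 * h x.2
          ∂(volume : Measure V).toSphere.prod (.volumeIoiPow (Module.finrank ℝ V - 1)) := by
      rw [← (volume : Measure V).measurePreserving_homeomorphUnitSphereProd.integral_comp
        (Homeomorph.measurableEmbedding _)]
      refine integral_congr_ae (.of_forall fun x => ?_)
      change f x.1 = F _ * h _
      rw [← hf _ _ (Subtype.prop ((homeomorphUnitSphereProd V x).2))]
      congr 1
      have hx : ‖(x : V)‖ ≠ 0 := norm_ne_zero_iff.2 x.2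
      simp [smul_smul, hx]
    _ = (∫ y, F y ∂(volume : Measure V).toSphere) *
          ∫ x : Ioi (0 : ℝ), h x ∂.volumeIoiPow (Module.finrank ℝ V - 1) :=
      integral_prod_mul F (fun x : Ioi (0 : ℝ) => h x)
    _ = _ := by
      congr 1
      simp only [Measure.volumeIoiPow, ENNReal.ofReal]
      rw [integral_withDensity_eq_integral_smul,
        integral_subtype_comap measurableSet_Ioi
          fun a ↦ Real.toNNReal (a ^ (Module.finrank ℝ V - 1)) • h a,
        setIntegral_congr_fun measurableSet_Ioi fun x hx ↦ ?_]
      · rw [NNReal.smul_def, Real.coe_toNNReal _ (pow_nonneg hx.out.le _), smul_eq_mul]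
      · exact (measurable_subtype_coe.pow_const _).real_toNNReal

/-- In an orthonormal basis with `x` as a member the integrand is a product over the coordinates:
the one along `x` carries the power, the others are pure Gaussians. -/
theorem integral_inner_pow_mul_exp_neg_norm_sq (k : ℕ) (x : V) (hx : ‖x‖ = 1) :
    ∫ v : V, ⟪x, v⟫_ℝ ^ (2 * k) * exp (-‖v‖ ^ 2) =
      Gamma ((k : ℝ) + 1 / 2) * Gamma (1 / 2) ^ (Module.finrank ℝ V - 1) := by
  obtain ⟨n, hn⟩ : ∃ n, Module.finrank ℝ V = n + 1 := by
    refine Nat.exists_eq_succ_of_ne_zero fun h => ?_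
    have := Module.finrank_zero_iff.1 h
    simp [Subsingleton.elim x 0] at hx
  obtain ⟨b, hb⟩ := exists_orthonormalBasis_apply_eq hn 0 x hx
  have key : ∀ y : Fin (n + 1) → ℝ,
      ⟪x, b.repr.symm (WithLp.toLp 2 y)⟫_ℝ ^ (2 * k) *
        exp (-‖b.repr.symm (WithLp.toLp 2 y)‖ ^ 2) =
      ∏ i, (fun i (t : ℝ) => t ^ (2 * (if i = 0 then k else 0)) * exp (-t ^ 2)) i (y i) := by
    intro y
    rw [← hb, ← b.repr_apply_apply, LinearIsometryEquiv.apply_symm_apply,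
      LinearIsometryEquiv.norm_map, EuclideanSpace.norm_sq_eq, Finset.prod_mul_distrib,
      ← Finset.sum_neg_distrib, exp_sum]
    congr 1
    · rw [Finset.prod_eq_single 0] <;> simp +contextual
    · simp
  rw [← b.measurePreserving_repr_symm.integral_comp
      b.repr.symm.toHomeomorph.measurableEmbedding,
    ← (PiLp.volume_preserving_toLp (Fin (n + 1))).integral_comp
      (MeasurableEquiv.toLp 2 _).measurableEmbedding]
  simp only [key]
  rw [integral_fintype_prod_volume_eq_prod
    (fun i (t : ℝ) => t ^ (2 * (if i = (0 : Fin (n + 1)) then k else 0)) * exp (-t ^ 2))]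
  simp only [integral_even_pow_mul_exp_neg_sq]
  rw [Fin.prod_univ_succ, hn]
  simp [Fin.succ_ne_zero]

theorem Gamma_add_natCast_div (a : ℝ) (ha : 0 < a) (k : ℕ) :
    Gamma (a + k) = (∏ j ∈ Finset.range k, (a + j)) * Gamma a := by
  induction k with
  | zero => simp
  | succ k ih =>
    rw [Finset.prod_range_succ, Nat.cast_succ, ← add_assoc, Gamma_add_one (by positivity), ih]
    ring

/-- In polar coordinates the Gaussian integral is a spherical integral times a radial one. Comparing
exponent `2 * k` with exponent 0 eliminates the total surface mass and the powers of `Γ(1/2)`. -/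
theorem integral_sphere_inner_pow (k : ℕ) (x : V) (hx : ‖x‖ = 1) :
    ∫ y : Metric.sphere (0 : V) 1, ⟪x, (y : V)⟫_ℝ ^ (2 * k) ∂(sphereProb V) =
      (∏ j ∈ Finset.range k, (1 + 2 * (j : ℝ))) /
        ∏ j ∈ Finset.range k, ((Module.finrank ℝ V : ℝ) + 2 * (j : ℝ)) := by
  have hnt : Nontrivial V := ⟨x, 0, fun h => by simp [h] at hx⟩
  obtain ⟨n, hn⟩ : ∃ n, Module.finrank ℝ V = n + 1 :=
    Nat.exists_eq_succ_of_ne_zero Module.finrank_pos.ne'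
  set σ := (volume : Measure V).toSphere with hσ
  have polar : ∀ k : ℕ, (∫ y : Metric.sphere (0 : V) 1, ⟪x, (y : V)⟫_ℝ ^ (2 * k) ∂σ) *
      (1 / 2 * Gamma (((n : ℝ) + 1) / 2 + k)) = Gamma ((1 : ℝ) / 2 + k) * Gamma (1 / 2) ^ n := by
    intro k
    have h := integral_polar (V := V) (fun y => ⟪x, (y : V)⟫_ℝ ^ (2 * k))
      (fun r => r ^ (2 * k) * exp (-r ^ 2)) (fun v => ⟪x, v⟫_ℝ ^ (2 * k) * exp (-‖v‖ ^ 2))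
      (fun y r hr => by
        have hy : ‖(y : V)‖ = 1 := by simp
        simp only [inner_smul_right, norm_smul, hy, mul_one, norm_eq_abs, sq_abs]
        ring)
    simp only [← mul_assoc, ← pow_add] at h
    rw [integral_inner_pow_mul_exp_neg_norm_sq k x hx, integral_pow_mul_exp_neg_sq_Ioi, hn] at h
    rw [add_comm ((1 : ℝ) / 2) k, show n = n + 1 - 1 from rfl, h, hσ]
    congr 3
    push_cast [Nat.add_sub_cancel]
    ring
  have h0 := polar 0
  have hk := polar k
  rw [Gamma_add_natCast_div _ (by positivity), Gamma_add_natCast_div _ (by norm_num)] at hk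
  have hg : 0 < Gamma (((n : ℝ) + 1) / 2) := Gamma_pos_of_pos (by positivity)
  have hs : σ.real univ ≠ 0 := by
    rw [measureReal_def, ENNReal.toReal_ne_zero]
    exact ⟨measure_univ_ne_zero.2 (toSphere_ne_zero _), measure_ne_top _ _⟩
  have e1 : ∀ a : ℝ, ∏ j ∈ Finset.range k, (a + 2 * (j : ℝ)) =
      2 ^ k * ∏ j ∈ Finset.range k, (a / 2 + j) := by
    intro a
    rw [show (2 : ℝ) ^ k = ∏ _j ∈ Finset.range k, 2 by simp, ← Finset.prod_mul_distrib]
    exact Finset.prod_congr rfl fun j _ => by ring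
  have hp : 0 < ∏ j ∈ Finset.range k, (((n : ℝ) + 1) / 2 + j) :=
    Finset.prod_pos fun j _ => by positivity
  rw [sphereProb, integral_smul_measure, e1, e1, hn, ENNReal.toReal_inv, ← measureReal_def,
    smul_eq_mul]
  push_cast
  simp only [mul_zero, pow_zero, integral_const, smul_eq_mul, mul_one, Nat.cast_zero,
    add_zero] at h0
  rw [← hσ, mul_div_mul_left _ _ (by positivity), eq_div_iff hp.ne', inv_mul_eq_div,
    div_mul_eq_mul_div, div_eq_iff hs]
  refine mul_right_cancel₀ (b := 1 / 2 * Gamma (((n : ℝ) + 1) / 2)) (by positivity) ?_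
  linear_combination hk - (∏ j ∈ Finset.range k, ((1 : ℝ) / 2 + j)) * h0

theorem doubleFactorial_eq_prod_range (k : ℕ) :
    (Nat.doubleFactorial (2 * k - 1) : ℝ) = ∏ j ∈ Finset.range k, (1 + 2 * (j : ℝ)) := by
  cases k with
  | zero => simp
  | succ k =>
    rw [show 2 * (k + 1) - 1 = 2 * k + 1 by omega, Nat.doubleFactorial_eq_prod_odd,
      Finset.prod_range_succ']
    push_cast
    simp only [mul_zero, add_zero, mul_one]
    exact Finset.prod_congr rfl fun j _ => by ring

instance [Nontrivial V] : IsProbabilityMeasure (sphereProb V) := by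
  refine ⟨?_⟩
  rw [sphereProb, Measure.smul_apply, smul_eq_mul]
  exact ENNReal.inv_mul_cancel (measure_univ_ne_zero.2 (toSphere_ne_zero _)) (measure_ne_top _ _)

theorem sphereMoment_eq [Nontrivial V] (k : ℕ) :
    sphereMoment V k = (Nat.doubleFactorial (2 * k - 1) : ℝ) /
      ∏ j ∈ Finset.range k, ((Module.finrank ℝ V : ℝ) + 2 * (j : ℝ)) := by
  have hc : Continuous fun p : Metric.sphere (0 : V) 1 × Metric.sphere (0 : V) 1 =>
      ⟪(p.1 : V), (p.2 : V)⟫_ℝ ^ (2 * k) := by fun_prop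
  have hint := hc.integrable_of_hasCompactSupport
    (μ := (sphereProb V).prod (sphereProb V)) (HasCompactSupport.of_compactSpace _)
  rw [sphereMoment, integral_prod _ hint]
  simp only
  rw [integral_congr_ae (.of_forall fun x : Metric.sphere (0 : V) 1 =>
    integral_sphere_inner_pow k (x : V) (by simp))]
  simp [doubleFactorial_eq_prod_range]

end SphereMoments

/-! ### Definiteness of the dot product and Gram matrices. -/

section DotProduct

variable {V : Type*} [NormedAddCommGroup V] [InnerProductSpace ℝ V] {n m : ℕ}

/-- The basis of `V^{⊗m}` formed by the tensors `e_{p 1} ⊗ ⋯ ⊗ e_{p m}`. -/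
def tensorBasis (e : OrthonormalBasis (Fin n) ℝ V) (m : ℕ) :
    Module.Basis (Fin m → Fin n) ℝ (⨂[ℝ]^m V) :=
  Basis.piTensorProduct (fun _ : Fin m => e.toBasis)

theorem tensorBasis_apply (e : OrthonormalBasis (Fin n) ℝ V) (p : Fin m → Fin n) :
    tensorBasis e m p = PiTensorProduct.tprod ℝ (fun j => e (p j)) := by
  rw [tensorBasis, Basis.piTensorProduct_apply]
  simp

theorem dot_tensorBasis (e : OrthonormalBasis (Fin n) ℝ V) (p q : Fin m → Fin n) :
    dot V m (tensorBasis e m p) (tensorBasis e m q) = if p = q then 1 else 0 := by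
  simp only [tensorBasis_apply, dot_tprod, e.inner_eq_ite, Finset.prod_ite_zero, funext_iff]
  simp

theorem dot_eq_sum_repr (e : OrthonormalBasis (Fin n) ℝ V) (t u : ⨂[ℝ]^m V) :
    dot V m t u = ∑ p, (tensorBasis e m).repr t p * (tensorBasis e m).repr u p := by
  conv_lhs => rw [← (tensorBasis e m).sum_repr t, ← (tensorBasis e m).sum_repr u]
  simp only [map_sum, map_smul, LinearMap.sum_apply, LinearMap.smul_apply, dot_tensorBasis]
  simp [mul_comm]

theorem dot_comm (e : OrthonormalBasis (Fin n) ℝ V) (t u : ⨂[ℝ]^m V) :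
    dot V m t u = dot V m u t := by
  simp only [dot_eq_sum_repr e, mul_comm]

theorem eq_zero_of_dot_self_eq_zero (e : OrthonormalBasis (Fin n) ℝ V) {t : ⨂[ℝ]^m V}
    (h : dot V m t t = 0) : t = 0 := by
  rw [dot_eq_sum_repr e, Finset.sum_eq_zero_iff_of_nonneg fun _ _ => mul_self_nonneg _] at h
  refine (tensorBasis e m).ext_elem fun p => ?_
  simpa using h p (Finset.mem_univ p)

theorem eq_of_dot_tprod_eq (e : OrthonormalBasis (Fin n) ℝ V) {t u : ⨂[ℝ]^m V}
    (h : ∀ y : Fin m → V,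
      dot V m t (PiTensorProduct.tprod ℝ y) = dot V m u (PiTensorProduct.tprod ℝ y)) :
    t = u := by
  have htu : dot V m t = dot V m u := PiTensorProduct.ext (MultilinearMap.ext h)
  refine sub_eq_zero.1 (eq_zero_of_dot_self_eq_zero e ?_)
  rw [(dot V m).map_sub t u, htu, sub_self, LinearMap.zero_apply]

/-- The Gram matrix of a linearly independent family is invertible. -/
theorem isUnit_det_gram {m₀ : ℕ} (e : OrthonormalBasis (Fin n) ℝ V) {v : Fin m₀ → ⨂[ℝ]^m V}
    (hv : LinearIndependent ℝ v) : IsUnit (gram v).det := by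
  rw [isUnit_iff_ne_zero, Ne, ← Matrix.exists_mulVec_eq_zero_iff]
  rintro ⟨c, hc, h⟩
  -- A kernel vector `c` makes `∑ c i • v i` orthogonal to every `v i`, hence to itself.
  refine hc (funext fun i => Fintype.linearIndependent_iff.1 hv c
    (eq_zero_of_dot_self_eq_zero e ?_) i)
  simp only [map_sum, map_smul, LinearMap.sum_apply, LinearMap.smul_apply]
  refine Finset.sum_eq_zero fun i _ => ?_
  have := congrFun h i
  simp only [Matrix.mulVec, dotProduct, gram, Matrix.of_apply, Pi.zero_apply] at this
  rw [smul_eq_mul]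
  refine mul_eq_zero_of_right _ ?_
  rw [← this]
  exact Finset.sum_congr rfl fun j _ => by rw [smul_eq_mul, mul_comm, dot_comm e]

/-- A tensor in the span of `v` that has dot product `1` with every `v j` has the row sums of the
inverse Gram matrix as its coordinates. -/
theorem sum_rowSum_inv_gram_smul_eq {m₀ : ℕ} (e : OrthonormalBasis (Fin n) ℝ V)
    {v : Fin m₀ → ⨂[ℝ]^m V} (hv : LinearIndependent ℝ v) {t : ⨂[ℝ]^m V}
    (ht : t ∈ Submodule.span ℝ (Set.range v)) (h : ∀ j, dot V m t (v j) = 1) :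
    ∑ i, (∑ j, (gram v)⁻¹ i j) • v i = t := by
  obtain ⟨c, rfl⟩ := (Submodule.mem_span_range_iff_exists_fun ℝ).1 ht
  have hc : Matrix.mulVec (gram v) c = fun _ => 1 := by
    funext j
    rw [← h j]
    simp only [Matrix.mulVec, dotProduct, gram, Matrix.of_apply, map_sum, map_smul,
      LinearMap.sum_apply, LinearMap.smul_apply, smul_eq_mul]
    exact Finset.sum_congr rfl fun i _ => by rw [mul_comm, dot_comm e]
  have hc' : Matrix.mulVec (gram v)⁻¹ (fun _ => 1) = c := by
    rw [← hc, Matrix.mulVec_mulVec, Matrix.nonsing_inv_mul _ (isUnit_det_gram e hv),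
      Matrix.one_mulVec]
  refine Finset.sum_congr rfl fun i _ => ?_
  rw [← congrFun hc' i]
  simp [Matrix.mulVec, dotProduct]

end DotProduct

/-! ### Invariance of `I(P)` and its pairing with decomposable tensors. -/

section StandardInvariants

variable {V : Type*} [NormedAddCommGroup V] [InnerProductSpace ℝ V] {n m : ℕ}

theorem filter_partOf_eq (P : Finpartition (Finset.univ : Finset (Fin m)))
    (J : {J : Finset (Fin m) // J ∈ P.parts}) :
    Finset.univ.filter (fun j => partOf P j = J) = J.1 := by
  ext j
  simp [partOf, Subtype.ext_iff, P.part_eq_iff_mem J.2]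

theorem dot_stdInv_tprod_eq_sum (e : OrthonormalBasis (Fin n) ℝ V) (P : Pairing m)
    (y : Fin m → V) :
    dot V m (stdInv e P) (PiTensorProduct.tprod ℝ y) =
      ∑ i : {J : Finset (Fin m) // J ∈ P.1.parts} → Fin n,
        ∏ j, ⟪e (i (partOf P.1 j)), y j⟫_ℝ := by
  simp only [stdInv, placed, map_sum, LinearMap.sum_apply, dot_tprod]

/-- The dot product of `I(P)` and `y₁ ⊗ ⋯ ⊗ y_m` does not depend on the orthonormal basis. -/
theorem dot_stdInv_tprod_congr (e e' : OrthonormalBasis (Fin n) ℝ V) (P : Pairing m)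
    (y : Fin m → V) :
    dot V m (stdInv e P) (PiTensorProduct.tprod ℝ y) =
      dot V m (stdInv e' P) (PiTensorProduct.tprod ℝ y) := by
  -- By distributivity the sum over index functions becomes a product over parts; on a part `{a, b}`
  -- Parseval then leaves `⟪y a, y b⟫`, which is free of the basis.
  have aux : ∀ e : OrthonormalBasis (Fin n) ℝ V,
      dot V m (stdInv e P) (PiTensorProduct.tprod ℝ y) =
        ∏ J : {J : Finset (Fin m) // J ∈ P.1.parts}, ∑ c, ∏ j ∈ J.1, ⟪e c, y j⟫_ℝ := by
    intro e
    rw [dot_stdInv_tprod_eq_sum, Fintype.prod_sum]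
    refine Finset.sum_congr rfl fun i _ => ?_
    rw [← Finset.prod_fiberwise Finset.univ (partOf P.1)]
    refine Finset.prod_congr rfl fun J _ => ?_
    rw [← filter_partOf_eq P.1 J]
    refine Finset.prod_congr rfl fun j hj => ?_
    rw [(Finset.mem_filter.1 hj).2]
  rw [aux, aux]
  refine Finset.prod_congr rfl fun J _ => ?_
  obtain ⟨a, b, hab, hJ⟩ := Finset.card_eq_two.1 (P.2 J.1 J.2)
  simp only [hJ, Finset.prod_pair hab]
  have hsum : ∀ e : OrthonormalBasis (Fin n) ℝ V,
      ∑ c, ⟪e c, y a⟫_ℝ * ⟪e c, y b⟫_ℝ = ⟪y a, y b⟫_ℝ := fun e => by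
    simp only [real_inner_comm (y a) (e _)]
    exact e.sum_inner_mul_inner _ _
  rw [hsum, hsum]

theorem stdInv_congr (e e' : OrthonormalBasis (Fin n) ℝ V) (P : Pairing m) :
    stdInv e P = stdInv e' P :=
  eq_of_dot_tprod_eq e (dot_stdInv_tprod_congr e e' P)

/-- An isometry `g` carries `I(P)` formed with `e` to `I(P)` formed with the orthonormal basis `g
e`, which is the same tensor. -/
theorem stdInv_mem_invariants (e : OrthonormalBasis (Fin n) ℝ V) (P : Pairing m) :
    stdInv e P ∈ invariants V m := by
  rw [mem_invariants]
  intro g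
  conv_rhs => rw [stdInv_congr e (e.map g)]
  simp [stdInv, placed]

/-- `dot (I(Q)) (e_f)` detects whether the colouring `f` is constant on the parts of `Q`. -/
theorem dot_stdInv_tensorBasis (e : OrthonormalBasis (Fin n) ℝ V) (Q : Pairing m)
    (f : Fin m → Fin n) [Decidable (∀ J ∈ Q.1.parts, ∀ x ∈ J, ∀ y ∈ J, f x = f y)] :
    dot V m (stdInv e Q) (PiTensorProduct.tprod ℝ (fun j => e (f j))) =
      if ∀ J ∈ Q.1.parts, ∀ x ∈ J, ∀ y ∈ J, f x = f y then 1 else 0 := by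
  rw [dot_stdInv_tprod_eq_sum]
  simp only [e.inner_eq_ite, Finset.prod_ite_zero, Finset.prod_const_one, Finset.mem_univ,
    true_implies]
  split_ifs with h
  · have hne : ∀ J : {J : Finset (Fin m) // J ∈ Q.1.parts}, ∃ x, x ∈ J.1 := fun J =>
      Q.1.nonempty_of_mem_parts J.2
    choose r hr using hne
    have hmem : ∀ j, j ∈ (partOf Q.1 j).1 := fun j => Q.1.mem_part_self.2 (Finset.mem_univ j)
    -- The only index function that contributes reads off the colour at a representative of each
    -- part.
    rw [Finset.sum_eq_single (fun J => f (r J))]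
    · rw [if_pos fun j => h _ (partOf Q.1 j).2 _ (hr _) _ (hmem j)]
    · intro i _ hi
      refine if_neg fun hif => hi (funext fun J => ?_)
      rw [← hif (r J)]
      congr 1
      exact (Subtype.ext (Q.1.part_eq_of_mem J.2 (hr J))).symm
    · simp
  · refine Finset.sum_eq_zero fun i _ => if_neg fun hif => h fun J hJ x hx y hy => ?_
    rw [← hif x, ← hif y]
    congr 1
    exact Subtype.ext ((Q.1.part_eq_of_mem hJ hx).trans (Q.1.part_eq_of_mem hJ hy).symm)

end StandardInvariants

/-! ### Counting perfect matchings compatible with a colouring. -/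

section Matchings

open scoped Finset

variable {α ι : Type*}

open Classical in
/-- The sets `T` of pairwise disjoint two-element subsets of `s` that cover `s` and on each of which
the colouring `f` is constant. -/
def matchings (f : α → ι) (s : Finset α) : Finset (Finset (Finset α)) :=
  {T ∈ s.powerset.powerset | (∀ J ∈ T, J.card = 2 ∧ ∀ x ∈ J, ∀ y ∈ J, f x = f y) ∧
    ∀ x ∈ s, ∃! J, J ∈ T ∧ x ∈ J}

theorem mem_matchings {f : α → ι} {s : Finset α} {T : Finset (Finset α)} :
    T ∈ matchings f s ↔ (∀ J ∈ T, J ⊆ s) ∧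
      (∀ J ∈ T, J.card = 2 ∧ ∀ x ∈ J, ∀ y ∈ J, f x = f y) ∧ ∀ x ∈ s, ∃! J, J ∈ T ∧ x ∈ J := by
  simp only [matchings, Finset.mem_filter, Finset.mem_powerset, Finset.subset_iff (s₁ := T)]

/-- The number of perfect matchings of a set with `c` elements. -/
def matchingNumber : ℕ → ℕ
  | 0 => 1
  | 1 => 0
  | c + 2 => (c + 1) * matchingNumber c

theorem matchings_empty (f : α → ι) : matchings f ∅ = {∅} := by
  ext T
  rw [mem_matchings, Finset.mem_singleton]
  constructor
  · rintro ⟨h, h2, -⟩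
    refine Finset.eq_empty_of_forall_notMem fun J hJ => ?_
    have := (h2 J hJ).1
    simp [Finset.subset_empty.1 (h J hJ)] at this
  · rintro rfl
    simp

variable [DecidableEq α]

theorem insert_pair_mem_matchings {f : α → ι} {s : Finset α} {a b : α} (ha : a ∈ s) (hb : b ∈ s)
    (hab : a ≠ b) (hf : f a = f b) {T : Finset (Finset α)} (hT : T ∈ matchings f (s \ {a, b})) :
    insert {a, b} T ∈ matchings f s := by
  rw [mem_matchings] at hT ⊢
  obtain ⟨h1, h2, h3⟩ := hT
  refine ⟨?_, ?_, ?_⟩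
  · intro J hJ
    rcases Finset.mem_insert.1 hJ with rfl | hJ
    · simp [Finset.insert_subset_iff, ha, hb]
    · exact (h1 J hJ).trans Finset.sdiff_subset
  · intro J hJ
    rcases Finset.mem_insert.1 hJ with rfl | hJ
    · exact ⟨Finset.card_pair hab, by simp [hf]⟩
    · exact h2 J hJ
  · intro x hx
    by_cases hxab : x ∈ ({a, b} : Finset α)
    · refine ⟨{a, b}, ⟨Finset.mem_insert_self _ _, hxab⟩, ?_⟩
      rintro J ⟨hJ, hxJ⟩
      rcases Finset.mem_insert.1 hJ with rfl | hJ
      · rfl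
      · exact ((Finset.mem_sdiff.1 (h1 J hJ hxJ)).2 hxab).elim
    · obtain ⟨J, ⟨hJ, hxJ⟩, hu⟩ := h3 x (Finset.mem_sdiff.2 ⟨hx, hxab⟩)
      refine ⟨J, ⟨Finset.mem_insert_of_mem hJ, hxJ⟩, ?_⟩
      rintro J' ⟨hJ', hxJ'⟩
      rcases Finset.mem_insert.1 hJ' with rfl | hJ'
      · exact (hxab hxJ').elim
      · exact hu J' ⟨hJ', hxJ'⟩

theorem erase_pair_mem_matchings {f : α → ι} {s : Finset α} {a b : α} {T : Finset (Finset α)}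
    (hT : T ∈ matchings f s) (hab : {a, b} ∈ T) : T.erase {a, b} ∈ matchings f (s \ {a, b}) := by
  rw [mem_matchings] at hT ⊢
  obtain ⟨h1, h2, h3⟩ := hT
  refine ⟨?_, fun J hJ => h2 J (Finset.mem_of_mem_erase hJ), ?_⟩
  · intro J hJ x hx
    have hJT := Finset.mem_of_mem_erase hJ
    refine Finset.mem_sdiff.2 ⟨h1 J hJT hx, fun hxab => Finset.ne_of_mem_erase hJ ?_⟩
    exact (h3 x (h1 J hJT hx)).unique ⟨hJT, hx⟩ ⟨hab, hxab⟩
  · intro x hx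
    obtain ⟨hxs, hxab⟩ := Finset.mem_sdiff.1 hx
    obtain ⟨J, ⟨hJ, hxJ⟩, hu⟩ := h3 x hxs
    refine ⟨J, ⟨Finset.mem_erase.2 ⟨fun h => hxab (h ▸ hxJ), hJ⟩, hxJ⟩, ?_⟩
    rintro J' ⟨hJ', hxJ'⟩
    exact hu J' ⟨Finset.mem_of_mem_erase hJ', hxJ'⟩

theorem pair_notMem_of_mem_matchings {f : α → ι} {s : Finset α} {a b : α} {T : Finset (Finset α)}
    (hT : T ∈ matchings f (s \ {a, b})) : {a, b} ∉ T := fun h => by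
  have := (mem_matchings.1 hT).1 _ h (Finset.mem_insert_self a {b})
  simp at this

/-- Matchings are classified by the partner `b` of `a`, which must have the colour of `a`. -/
theorem card_matchings_eq_sum [DecidableEq ι] (f : α → ι) {s : Finset α} {a : α} (ha : a ∈ s) :
    (matchings f s).card =
      ∑ b ∈ s.erase a with f b = f a, (matchings f (s \ {a, b})).card := by
  rw [← Finset.card_sigma]
  symm
  refine Finset.card_bij (fun p _ => insert {a, p.1} p.2) ?_ ?_ ?_
  · rintro ⟨b, T⟩ h
    simp only [Finset.mem_sigma, Finset.mem_filter, Finset.mem_erase] at h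
    exact insert_pair_mem_matchings ha h.1.1.2 h.1.1.1.symm h.1.2.symm h.2
  · rintro ⟨b, T⟩ h ⟨b', T'⟩ h' heq
    simp only [Finset.mem_sigma, Finset.mem_filter, Finset.mem_erase] at h h' heq
    have hT := insert_pair_mem_matchings ha h.1.1.2 h.1.1.1.symm h.1.2.symm h.2
    have hpair : ({a, b} : Finset α) = {a, b'} :=
      ((mem_matchings.1 hT).2.2 a ha).unique
        ⟨Finset.mem_insert_self _ _, Finset.mem_insert_self _ _⟩
        ⟨heq ▸ Finset.mem_insert_self _ _, Finset.mem_insert_self _ _⟩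
    have hb : b = b' := by
      have hb : b ∈ ({a, b'} : Finset α) := hpair ▸ by simp
      simpa [h.1.1.1] using hb
    subst hb
    have hTT : T = T' := by
      rw [← Finset.erase_insert (pair_notMem_of_mem_matchings h.2), heq,
        Finset.erase_insert (pair_notMem_of_mem_matchings h'.2)]
    rw [hTT]
  · intro T hT
    obtain ⟨h1, h2, h3⟩ := mem_matchings.1 hT
    obtain ⟨J, ⟨hJ, haJ⟩, -⟩ := h3 a ha
    obtain ⟨b, hb, hJb⟩ : ∃ b, b ≠ a ∧ J = {a, b} := by
      obtain ⟨x, y, hxy, rfl⟩ := Finset.card_eq_two.1 (h2 J hJ).1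
      rcases Finset.mem_insert.1 haJ with rfl | h
      · exact ⟨y, hxy.symm, rfl⟩
      · rw [Finset.mem_singleton] at h
        subst h
        exact ⟨x, hxy, Finset.pair_comm _ _⟩
    subst hJb
    have hbJ : b ∈ ({a, b} : Finset α) := by simp
    refine ⟨⟨b, T.erase {a, b}⟩, ?_, Finset.insert_erase hJ⟩
    simp only [Finset.mem_sigma, Finset.mem_filter, Finset.mem_erase]
    exact ⟨⟨⟨hb, h1 _ hJ hbJ⟩, (h2 _ hJ).2 _ hbJ _ haJ⟩, erase_pair_mem_matchings hT hJ⟩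

/-- The number of matchings that are compatible with a colouring. -/
theorem card_matchings [Fintype ι] [DecidableEq ι] (f : α → ι) (s : Finset α) :
    (matchings f s).card = ∏ i, matchingNumber #{x ∈ s | f x = i} := by
  induction s using Finset.strongInduction with
  | H s ih =>
    rcases s.eq_empty_or_nonempty with rfl | ⟨a, ha⟩
    · simp [matchings_empty, matchingNumber]
    rw [card_matchings_eq_sum f ha]
    set R := ∏ i ∈ Finset.univ.erase (f a), matchingNumber #{x ∈ s | f x = i} with hR
    have hA : a ∈ ({x ∈ s | f x = f a} : Finset α) := by simp [ha]
    have hcard : {b ∈ s.erase a | f b = f a}.card = #{x ∈ s | f x = f a} - 1 := by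
      rw [Finset.filter_erase, Finset.card_erase_of_mem hA]
    -- Removing `a` and `b` shrinks their common colour class by two and leaves the others alone, so
    -- the term does not depend on `b`.
    have hterm : ∀ b ∈ ({b ∈ s.erase a | f b = f a} : Finset α),
        (matchings f (s \ {a, b})).card =
          matchingNumber (#{x ∈ s | f x = f a} - 2) * R := by
      intro b hb
      simp only [Finset.mem_filter, Finset.mem_erase] at hb
      rw [ih _ (Finset.sdiff_ssubset (by simp [Finset.insert_subset_iff, ha, hb.1.2]) (by simp)),
        ← Finset.mul_prod_erase _ _ (Finset.mem_univ (f a)), hR]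
      congr 1
      · congr 1
        have hsub : ({a, b} : Finset α) ⊆ ({x ∈ s | f x = f a} : Finset α) := by
          simp [Finset.insert_subset_iff, ha, hb.1.2, hb.2]
        rw [← Finset.card_pair hb.1.1.symm, ← Finset.card_sdiff_of_subset hsub]
        congr 1
        ext x
        simp only [Finset.mem_filter, Finset.mem_sdiff]
        tauto
      · refine Finset.prod_congr rfl fun i hi => ?_
        have hi' := Finset.ne_of_mem_erase hi
        congr 2
        ext x
        simp only [Finset.mem_filter, Finset.mem_sdiff, Finset.mem_insert, Finset.mem_singleton]
        constructor
        · tauto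
        · rintro ⟨hx, hxi⟩
          refine ⟨⟨hx, ?_⟩, hxi⟩
          rintro (rfl | rfl)
          · exact hi' hxi.symm
          · exact hi' (hxi.symm.trans hb.2)
    rw [Finset.sum_congr rfl hterm, Finset.sum_const, hcard,
      ← Finset.mul_prod_erase _ _ (Finset.mem_univ (f a)), ← hR, smul_eq_mul, ← mul_assoc]
    congr 1
    obtain ⟨c, hc⟩ : ∃ c, #{x ∈ s | f x = f a} = c + 1 :=
      Nat.exists_eq_succ_of_ne_zero (Finset.card_ne_zero_of_mem hA)
    rw [hc]
    -- In a class of size 1 the truncated `1 - 2` is harmless: there is no partner, and both sides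
    -- vanish.
    cases c with
    | zero => simp [matchingNumber]
    | succ c => rfl

/-- Giving a new pair the colour `c`, already borne by `d_c` pairs, multiplies the product by `2 *
d_c + 1`. As the `d_c` add up to `k`, summing over `c` gives the factor `n + 2 * k`. -/
theorem sum_prod_matchingNumber_fin (n k : ℕ) :
    ∑ h : Fin k → Fin n, ∏ i, matchingNumber (2 * #{J | h J = i}) =
      ∏ j ∈ Finset.range k, (n + 2 * j) := by
  induction k with
  | zero => simp [matchingNumber]
  | succ k ih =>
    rw [Finset.prod_range_succ, ← ih, Finset.sum_mul,
      ← (Fin.consEquiv fun _ => Fin n).sum_comp, Fintype.sum_prod_type_right]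
    refine Finset.sum_congr rfl fun h _ => ?_
    have hcard : ∀ c i : Fin n,
        #{J : Fin (k + 1) | (Fin.cons c h : Fin (k + 1) → Fin n) J = i} =
          #{J | h J = i} + if c = i then 1 else 0 := by
      intro c i
      rw [Fin.card_filter_univ_succ]
      simp only [Fin.cons_zero, Fin.cons_succ]
      split_ifs <;> rfl
    have hstep : ∀ c : Fin n,
        ∏ i, matchingNumber (2 * #{J | (Fin.consEquiv fun _ => Fin n) (c, h) J = i}) =
          (2 * #{J | h J = c} + 1) * ∏ i, matchingNumber (2 * #{J | h J = i}) := by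
      intro c
      rw [← Finset.mul_prod_erase _ _ (Finset.mem_univ c),
        ← Finset.mul_prod_erase _ (fun i => matchingNumber (2 * #{J | h J = i}))
          (Finset.mem_univ c), ← mul_assoc]
      simp only [Fin.consEquiv_apply, hcard]
      refine congrArg₂ (· * ·) ?_ ?_
      · rw [if_pos trivial]
        rfl
      · refine Finset.prod_congr rfl fun i hi => ?_
        rw [if_neg (Finset.ne_of_mem_erase hi).symm, add_zero]
    have htotal : ∑ c, #{J | h J = c} = k := by
      rw [← Finset.card_eq_sum_card_fiberwise (fun _ _ => Finset.mem_coe.2 (Finset.mem_univ _))]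
      simp
    rw [Finset.sum_congr rfl fun c _ => hstep c, ← Finset.sum_mul, Finset.sum_add_distrib,
      ← Finset.mul_sum, htotal]
    simp
    ring

theorem sum_prod_matchingNumber {κ : Type*} [Fintype κ] [DecidableEq κ] (n : ℕ) :
    ∑ h : κ → Fin n, ∏ i, matchingNumber (2 * #{J | h J = i}) =
      ∏ j ∈ Finset.range (Fintype.card κ), (n + 2 * j) := by
  rw [← sum_prod_matchingNumber_fin]
  refine Fintype.sum_equiv ((Fintype.equivFin κ).arrowCongr (Equiv.refl _)) _ _ fun h => ?_
  refine Finset.prod_congr rfl fun i _ => ?_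
  congr 2
  exact Finset.card_equiv (Fintype.equivFin κ) (by simp)

end Matchings

/-! ### The dot product of `A_m` with a standard invariant. -/

section Pairings

open scoped Finset

open Classical in
-- Transfers the count to plain families of sets, for which the induction can shrink the ground set.
theorem card_pairing_filter {m n : ℕ} (f : Fin m → Fin n) :
    #{Q : Pairing m | ∀ J ∈ Q.1.parts, ∀ x ∈ J, ∀ y ∈ J, f x = f y} =
      (matchings f Finset.univ).card := by
  refine Finset.card_bij (fun Q _ => Q.1.parts) ?_ ?_ ?_
  · intro Q hQ
    rw [Finset.mem_filter] at hQ
    exact mem_matchings.2 ⟨fun J _ => Finset.subset_univ J, fun J hJ => ⟨Q.2 J hJ, hQ.2 J hJ⟩,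
      fun x hx => Q.1.existsUnique_mem hx⟩
  · intro Q _ Q' _ h
    exact Subtype.ext (Finpartition.ext h)
  · intro T hT
    obtain ⟨h1, h2, h3⟩ := mem_matchings.1 hT
    refine ⟨⟨Finpartition.ofExistsUnique T h1 h3 fun h => ?_, fun J hJ => (h2 J hJ).1⟩, ?_, rfl⟩
    · simpa using (h2 ∅ h).1
    · exact Finset.mem_filter.2 ⟨Finset.mem_univ _, fun J hJ => (h2 J hJ).2⟩

theorem card_parts_pairing {k : ℕ} (P : Pairing (2 * k)) : P.1.parts.card = k := by
  have h := P.1.sum_card_parts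
  rw [Finset.sum_congr rfl P.2] at h
  simp at h
  omega

theorem card_filter_comp_partOf {m n : ℕ} (P : Pairing m)
    (h : {J : Finset (Fin m) // J ∈ P.1.parts} → Fin n) (i : Fin n) :
    #{x : Fin m | h (partOf P.1 x) = i} = 2 * #{J | h J = i} := by
  rw [Finset.card_eq_sum_card_fiberwise (f := partOf P.1) (t := {J | h J = i})
    (by intro x hx; simpa using hx), mul_comm, ← smul_eq_mul, ← Finset.sum_const]
  refine Finset.sum_congr rfl fun J hJ => ?_
  refine Eq.trans (congrArg Finset.card ?_) (P.2 J.1 J.2)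
  rw [← filter_partOf_eq P.1 J, Finset.filter_filter]
  ext x
  simp only [Finset.mem_filter, Finset.mem_univ, true_and] at hJ ⊢
  constructor
  · exact And.right
  · rintro rfl
    exact ⟨hJ, rfl⟩

variable {V : Type*} [NormedAddCommGroup V] [InnerProductSpace ℝ V] {n : ℕ}

theorem sum_dot_stdInv_stdInv {k : ℕ} (e : OrthonormalBasis (Fin n) ℝ V) (P : Pairing (2 * k)) :
    ∑ Q : Pairing (2 * k), dot V (2 * k) (stdInv e Q) (stdInv e P) =
      ∏ j ∈ Finset.range k, ((n : ℝ) + 2 * (j : ℝ)) := by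
  classical
  have h := sum_prod_matchingNumber (κ := {J : Finset (Fin (2 * k)) // J ∈ P.1.parts}) n
  rw [Fintype.card_coe, card_parts_pairing] at h
  have h' := congrArg (Nat.cast : ℕ → ℝ) h
  push_cast at h'
  rw [← h']
  -- Only `I(P)` is expanded; `I(Q)` stays whole so that it can test each colouring.
  conv_lhs => enter [2, Q, 2]; rw [stdInv]
  simp only [map_sum, placed, dot_stdInv_tensorBasis]
  rw [Finset.sum_comm]
  refine Finset.sum_congr rfl fun i _ => ?_
  rw [Finset.sum_boole, card_pairing_filter (fun x => i (partOf P.1 x)), card_matchings]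
  push_cast
  simp only [card_filter_comp_partOf]

theorem dot_avgInv_stdInv {k : ℕ} (e : OrthonormalBasis (Fin n) ℝ V) (P : Pairing (2 * k)) :
    dot V (2 * k) (avgInv e k) (stdInv e P) =
      (∏ j ∈ Finset.range k, ((n : ℝ) + 2 * (j : ℝ))) / Nat.doubleFactorial (2 * k - 1) := by
  rw [avgInv, map_smul, LinearMap.smul_apply, map_sum, LinearMap.sum_apply,
    sum_dot_stdInv_stdInv, smul_eq_mul, one_div_mul_eq_div]

end Pairings

end InvTensor

end

/-! ### The main theorem. -/

theorem corollary1 {n k m₀ : ℕ} (hn : 1 ≤ n)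
    {V : Type*} [NormedAddCommGroup V] [InnerProductSpace ℝ V] [FiniteDimensional ℝ V]
    [MeasurableSpace V] [BorelSpace V]
    (e : OrthonormalBasis (Fin n) ℝ V)
    (P : Fin m₀ → InvTensor.Pairing (2 * k))
    (hli : LinearIndependent ℝ (fun i => InvTensor.stdInv e (P i)))
    (hspan : Submodule.span ℝ (Set.range (fun i => InvTensor.stdInv e (P i))) =
      InvTensor.invariants V (2 * k))
    (G₀ : Matrix (Fin m₀) (Fin m₀) ℝ)
    (hG₀ : G₀ = InvTensor.gram (fun i => InvTensor.stdInv e (P i)))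
    (s : Fin m₀ → ℝ) (hs : ∀ i, s i = ∑ j, G₀⁻¹ i j) :
    IsUnit G₀.det ∧
    ∑ i, s i • InvTensor.stdInv e (P i) =
      InvTensor.sphereMoment V k • InvTensor.avgInv e k ∧
    InvTensor.sphereMoment V k =
      (Nat.doubleFactorial (2 * k - 1) : ℝ) / ∏ j ∈ Finset.range k, ((n : ℝ) + 2 * (j : ℝ)) := by
  subst hG₀
  have hfr : Module.finrank ℝ V = n := by simpa using Module.finrank_eq_card_basis e.toBasis
  have hnt : Nontrivial V := Module.nontrivial_of_finrank_pos (R := ℝ) (by omega)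
  have hμ := InvTensor.sphereMoment_eq (V := V) k
  rw [hfr] at hμ
  refine ⟨InvTensor.isUnit_det_gram e hli, ?_, hμ⟩
  simp only [hs]
  refine InvTensor.sum_rowSum_inv_gram_smul_eq e hli ?_ fun j => ?_
  -- `hspan` puts `μ A_m` in the span, because each `I(Q)` is invariant.
  · rw [hspan]
    exact Submodule.smul_mem _ _ (Submodule.smul_mem _ _ (Submodule.sum_mem _ fun Q _ =>
      InvTensor.stdInv_mem_invariants e Q))
  · have hn' : (0 : ℝ) < n := Nat.cast_pos.2 hn
    have hprod : ∏ j ∈ Finset.range k, ((n : ℝ) + 2 * (j : ℝ)) ≠ 0 :=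
      Finset.prod_ne_zero_iff.2 fun j _ => by positivity
    have hdf : (Nat.doubleFactorial (2 * k - 1) : ℝ) ≠ 0 :=
      Nat.cast_ne_zero.2 (Nat.doubleFactorial_pos _).ne'
    rw [map_smul, LinearMap.smul_apply, InvTensor.dot_avgInv_stdInv, hμ, smul_eq_mul]
    field_simp
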